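/- Let $A_0=\begin{pmatrix}1&0\\1&1\end{pmatrix}$, $A_1=\begin{pmatrix}1&1\\0&1\end{pmatrix}$. For a real number $\alpha$, $M=\begin{pmatrix}0&-1\\0&\alpha\end{pmatrix}$, a real $\beta$ and $N\in\mathbb N$ let $$Z_N(\alpha;\beta)=\sum_{\sigma\in\{0,1\}^N}\frac1{|M*(A_{\sigma_1}\cdots A_{\sigma_N})|^{\beta}},\qquad A*B=\operatorname{Tr}(AB^T),$$ so that the summand is $|\alpha q-p|^{-\beta}$, where $\binom pq$ is the right column of $A_{\sigma_1}\cdots A_{\sigma_N}$. Theorem. Let $\alpha$ be a quadratic irrational, that is, an irrational real number with $a\alpha^2+b\alpha+c=0$ for some integers $a\ne0$, $b$, $c$. Then $\alpha$ has a 1-free energy limit for $\beta>2$: for every real $\beta>2$ the sequence $\frac{\log Z_N(\alpha;\beta)}{N}$ converges to a real number as $N\to\infty$. Moreover, if $\alpha>0$ has continued fraction expansion $[a_0;a_1,a_2,\dots]$, and if $N_m=a_0+a_1+\cdots+a_m$ and $q_{N_m}$ denotes the denominator in lowest terms of $[a_0;a_1,\dots,a_m]$, then the sequence $(a_n)$ is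 eventually periodic, the limit $\lambda=\lim_{m\to\infty}\frac{\log q_{N_m}}{N_m}$ exists as a real number, and for every real $\beta>2$ $$\lim_{N\to\infty}\frac{\log Z_N(\alpha;\beta)}{N}=\beta\,\lambda .$$ -/

import Mathlib

open Filter Topology

noncomputable section

namespace FreeEnergy

/-- The Hilbert-Schmidt product `A * B = Tr(A Bᵀ) = ∑ i j, a i j * b i j` of two matrices. -/
def hsProd {n : ℕ} (A B : Matrix (Fin n) (Fin n) ℝ) : ℝ :=
  (A * B.transpose).trace

/-- The partition function `Z_N(M)(β) = 1(M)(β)|(A_0, …, A_{k-1})^N` of a `k`-tuple of matrices: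
the sum, over all states `σ ∈ {0, …, k-1}^N`, of `1 / |M * (A_{σ_1} ⋯ A_{σ_N})|^β`. -/
def partitionFunction {n k : ℕ} (A : Fin k → Matrix (Fin n) (Fin n) ℝ)
    (M : Matrix (Fin n) (Fin n) ℝ) (N : ℕ) (β : ℝ) : ℝ :=
  ∑ σ : Fin N → Fin k, 1 / |hsProd M (List.ofFn fun i => A (σ i)).prod| ^ β

/-- The two Farey matrices `A_0` and `A_1`. -/
def fareyMatrix : Fin 2 → Matrix (Fin 2) (Fin 2) ℝ :=
  ![!![1, 0; 1, 1], !![1, 1; 0, 1]]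

/-- The Diophantine partition function `Z_N(α; β)`. -/
def diophantineZ (N : ℕ) (α β : ℝ) : ℝ :=
  partitionFunction fareyMatrix !![0, -1; 0, α] N β

/-- `α` has a `k`-free energy limit for `β > βc`: for every real `β > βc`, the sequence
`log Z_N(α; β) / N ^ k` converges to a (finite) real number as `N → ∞`. -/
def HasFreeEnergyLimit (k α βc : ℝ) : Prop :=
  ∀ β : ℝ, βc < β →
    ∃ L : ℝ, Tendsto (fun N : ℕ => Real.log (diophantineZ N α β) / (N : ℝ) ^ k) atTop (𝓝 L)

/-- A quadratic irrational: a real irrational root of a quadratic polynomial over the integers. -/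
def IsQuadraticIrrational (α : ℝ) : Prop :=
  Irrational α ∧ ∃ a b c : ℤ, a ≠ 0 ∧ (a : ℝ) * α ^ 2 + b * α + c = 0

/-- The partial quotient `a_n` of the continued fraction `α = [a_0; a_1, a_2, …]`. The default `0`
is used only after termination, hence never for an irrational number. -/
def partialQuotient (α : ℝ) : ℕ → ℝ
  | 0 => (GenContFract.of α).h
  | n + 1 => ((GenContFract.of α).partDens.get? n).getD 0

/-- `N_m = a_0 + a_1 + ⋯ + a_m`. -/
def cfIndex (α : ℝ) (m : ℕ) : ℝ :=
  ∑ i ∈ Finset.range (m + 1), partialQuotient α i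

/-- `q_{N_m}`: the denominator, in lowest terms, of the convergent `[a_0; a_1, …, a_m]`. -/
def cfDen (α : ℝ) (m : ℕ) : ℕ :=
  (α.convergent m).den

end FreeEnergy

end

/-! The sum is studied for all linear forms `y q - x p`, because removing the leftmost matrix turns
`(x, y)` into `(x - y, y)` or `(x, y - x)` (`formZ_succ`). If `x` and `y` are positive and
incommensurable, exactly one child is again positive, namely the next pair of the subtractive
Euclidean algorithm. The other has coefficients of opposite signs, so its terms never cancel, and
for `β > 2` its partition function is bounded uniformly in `N` (`exists_formZ_neg_left_le`). Hence
`Z_N` lies between `max ^ (-β)` and `(1 + S N) * min ^ (-β)`, with max and min taken over the `N`-th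
pair (`formZ_ge`, `exists_formZ_le`).

For a quadratic irrational, Lagrange's argument makes the orbit of `(1, α)` periodic up to a scalar
(`exists_iterate_add_eq_smul`), so `-log min / N` and `-log max / N` have the same limit `lam`, and
a squeeze gives `β * lam`. After `N_m` steps the minimum is `|α q - p|` for the `m`-th convergent `p
/ q`. Its product with `q` is at most 1 and, by Liouville, bounded below, so `log q / N_m` also
tends to `lam`.

For `α < 0` the form has mixed signs from the start, so `Z_N` stays between positive constants and
the limit is 0. -/

noncomputable section

namespace FreeEnergy

/-! ### The partition function on linear forms -/

/-- The partition function `∑ |y q - x p| ^ (-β)` of the linear form with coefficients `(-x, y)`. -/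
def formZ (N : ℕ) (β x y : ℝ) : ℝ :=
  partitionFunction fareyMatrix !![0, -x; 0, y] N β

theorem diophantineZ_eq_formZ (N : ℕ) (α β : ℝ) : diophantineZ N α β = formZ N β 1 α := rfl

theorem hsProd_form (x y : ℝ) (B : Matrix (Fin 2) (Fin 2) ℝ) :
    hsProd !![0, -x; 0, y] B = y * B 1 1 - x * B 0 1 := by
  rw [hsProd, Matrix.trace_fin_two, Matrix.mul_apply, Matrix.mul_apply, Fin.sum_univ_two,
    Fin.sum_univ_two]
  simp only [Matrix.transpose_apply, Matrix.of_apply, Matrix.cons_val', Matrix.cons_val_zero,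
    Matrix.cons_val_one, Matrix.cons_val_fin_one]
  ring

theorem formZ_zero (β x y : ℝ) : formZ 0 β x y = 1 / |y| ^ β := by
  simp [formZ, partitionFunction, hsProd_form]

theorem hsProd_fareyMatrix_zero_mul (x y : ℝ) (B : Matrix (Fin 2) (Fin 2) ℝ) :
    hsProd !![0, -x; 0, y] (fareyMatrix 0 * B) = hsProd !![0, -(x - y); 0, y] B := by
  rw [hsProd_form, hsProd_form, Matrix.mul_apply, Matrix.mul_apply, Fin.sum_univ_two,
    Fin.sum_univ_two]
  simp only [fareyMatrix, Matrix.of_apply, Matrix.cons_val', Matrix.cons_val_zero,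
    Matrix.cons_val_one, Matrix.cons_val_fin_one]
  ring

theorem hsProd_fareyMatrix_one_mul (x y : ℝ) (B : Matrix (Fin 2) (Fin 2) ℝ) :
    hsProd !![0, -x; 0, y] (fareyMatrix 1 * B) = hsProd !![0, -x; 0, y - x] B := by
  rw [hsProd_form, hsProd_form, Matrix.mul_apply, Matrix.mul_apply, Fin.sum_univ_two,
    Fin.sum_univ_two]
  simp only [fareyMatrix, Matrix.of_apply, Matrix.cons_val', Matrix.cons_val_zero,
    Matrix.cons_val_one, Matrix.cons_val_fin_one]
  ring

theorem formZ_succ (N : ℕ) (β x y : ℝ) :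
    formZ (N + 1) β x y = formZ N β (x - y) y + formZ N β x (y - x) := by
  simp only [formZ, partitionFunction]
  rw [← (Fin.consEquiv fun _ : Fin (N + 1) => Fin 2).sum_comp, Fintype.sum_prod_type,
    Fin.sum_univ_two]
  simp only [Fin.consEquiv_apply, List.ofFn_succ, Fin.cons_zero, Fin.cons_succ, List.prod_cons,
    hsProd_fareyMatrix_zero_mul, hsProd_fareyMatrix_one_mul]

theorem formZ_nonneg (N : ℕ) (β x y : ℝ) : 0 ≤ formZ N β x y :=
  Finset.sum_nonneg fun _ _ => by positivity

theorem formZ_neg (N : ℕ) (β x y : ℝ) : formZ N β (-x) (-y) = formZ N β x y := by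
  induction N generalizing x y with
  | zero => simp [formZ_zero]
  | succ N ih =>
    rw [formZ_succ, formZ_succ, ← ih (x - y), ← ih x]
    congr 2 <;> ring

/-! ### Forms of constant sign -/

/-- From `log (1 + t) ≥ t / 2` one gets `(1 + t) ^ γ ≥ 1 + γ t / 2`; the difference is then at least
`γ t / (2 + γ t)`, and `t ≤ 1` gives the linear bound. -/
theorem one_sub_one_add_rpow_neg_ge {γ t : ℝ} (hγ : 0 < γ) (h0 : 0 ≤ t) (h1 : t ≤ 1) :
    γ / (2 + γ) * t ≤ 1 - (1 + t) ^ (-γ) := by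
  have hlog : t / 2 ≤ Real.log (1 + t) := by
    have := Real.one_sub_inv_le_log_of_pos (show 0 < 1 + t by linarith)
    refine le_trans ?_ this
    rw [← one_div, le_sub_iff_add_le, div_add_div _ _ (by norm_num) (by linarith),
      div_le_one (by linarith)]
    nlinarith
  have hpow : (1 + t) ^ (-γ) ≤ 1 / (1 + γ * t / 2) := by
    rw [Real.rpow_neg (by linarith), ← one_div]
    refine one_div_le_one_div_of_le (by positivity) ?_
    rw [Real.rpow_def_of_pos (by linarith)]
    refine le_trans ?_ (Real.add_one_le_exp _)
    nlinarith
  refine le_trans ?_ (sub_le_sub_left hpow 1)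
  have hpos : 0 < 1 + γ * t / 2 := by positivity
  rw [le_sub_iff_add_le, div_mul_eq_mul_div, div_add_div _ _ (by positivity) hpos.ne',
    div_le_one (by positivity)]
  have : 0 ≤ γ ^ 2 * t * (1 - t) := by
    have := sub_nonneg.2 h1
    positivity
  nlinarith

theorem rpow_neg_sub_rpow_neg_add_ge {γ s y : ℝ} (hγ : 0 < γ) (hy : 0 ≤ y) (hys : y ≤ s)
    (hs : 0 < s) :
    γ / (2 + γ) * (y / s) * s ^ (-γ) ≤ s ^ (-γ) - (s + y) ^ (-γ) := by
  have h := one_sub_one_add_rpow_neg_ge hγ (div_nonneg hy hs.le) ((div_le_one hs).2 hys)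
  have hmul : (s + y) ^ (-γ) = s ^ (-γ) * (1 + y / s) ^ (-γ) := by
    rw [← Real.mul_rpow hs.le (by positivity)]
    congr 1
    field_simp
  rw [hmul]
  nlinarith [Real.rpow_nonneg hs.le (-γ)]

/-- A potential dominating the partition function of a form of constant sign. -/
theorem formZ_neg_left_le {γ x y : ℝ} (hγ : 0 < γ) (hx : 0 < x) (hy : 0 < y) (N : ℕ) :
    formZ N (γ + 2) (-x) y ≤
      y ^ (-(γ + 2)) + (2 + γ) / γ * ((x + y) ^ (-γ) / (x * y)) := by
  -- The weight `(x + y) ^ (-γ) / (x * y)` nearly splits over the two children, since `1 / (s y) + 1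
  -- / (x s) = 1 / (x y)` for `s = x + y`. The decay of the power saves `s ^ (-γ) / s ^ 2 = s ^ (-(γ
  -- + 2))` in each child, and one such saving pays for the new leading term of the child `(-x, s)`.
  -- The factor `(2 + γ) / γ` normalises the saving.
  induction N generalizing x y with
  | zero =>
    rw [formZ_zero, abs_of_pos hy, one_div, ← Real.rpow_neg hy.le]
    have : 0 ≤ (2 + γ) / γ * ((x + y) ^ (-γ) / (x * y)) := by positivity
    linarith
  | succ N ih =>
    rw [formZ_succ]
    have e1 : formZ N (γ + 2) (-x - y) y = formZ N (γ + 2) (-(x + y)) y := by congr 1; ring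
    have e2 : formZ N (γ + 2) (-x) (y - -x) = formZ N (γ + 2) (-x) (x + y) := by congr 1; ring
    rw [e1, e2]
    have hs : 0 < x + y := by positivity
    have h1 := ih hs hy
    have h2 := ih hx hs
    have g1 := rpow_neg_sub_rpow_neg_add_ge hγ hy.le (by linarith : y ≤ x + y) hs
    have g2 := rpow_neg_sub_rpow_neg_add_ge hγ hx.le (by linarith : x ≤ x + y) hs
    have hpow : (x + y) ^ (-(γ + 2)) = (x + y) ^ (-γ) / (x + y) ^ 2 := by
      rw [neg_add, ← sub_eq_add_neg, Real.rpow_sub hs, Real.rpow_two]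
    rw [hpow] at h2
    rw [show x + (x + y) = x + y + x by ring] at h2
    set A := (x + y) ^ (-γ) with hA
    set B := (x + y + y) ^ (-γ) with hB
    set C := (x + y + x) ^ (-γ) with hC
    set s := x + y with hsdef
    have hApos : 0 < A := by positivity
    have k1 : (2 + γ) / γ * (B / (s * y)) ≤ (2 + γ) / γ * (A / (s * y)) - A / s ^ 2 := by
      have : A / s ^ 2 = (2 + γ) / γ * (γ / (2 + γ) * (y / s) * A / (s * y)) := by
        field_simp
      rw [this, ← mul_sub, ← sub_div]
      gcongr
      linarith
    have k2 : (2 + γ) / γ * (C / (x * s)) ≤ (2 + γ) / γ * (A / (x * s)) - A / s ^ 2 := by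
      have : A / s ^ 2 = (2 + γ) / γ * (γ / (2 + γ) * (x / s) * A / (x * s)) := by
        field_simp
      rw [this, ← mul_sub, ← sub_div]
      gcongr
      linarith
    have k3 : A / (s * y) + A / (x * s) = A / (x * y) := by
      rw [hsdef] at hs ⊢
      field_simp
    have k4 : 0 ≤ A / s ^ 2 := by positivity
    rw [← k3, mul_add]
    linarith

theorem exists_formZ_neg_left_le {β : ℝ} (hβ : 2 < β) :
    ∃ S : ℝ, 0 < S ∧ ∀ (N : ℕ) (x y m : ℝ), 0 < m → m ≤ x → m ≤ y →
      formZ N β (-x) y ≤ S * m ^ (-β) := by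
  obtain ⟨γ, hγ, rfl⟩ : ∃ γ : ℝ, 0 < γ ∧ β = γ + 2 := ⟨β - 2, by linarith, by ring⟩
  refine ⟨1 + (2 + γ) / γ, by positivity, fun N x y m hm hx hy => ?_⟩
  refine (formZ_neg_left_le hγ (by linarith) (by linarith) N).trans ?_
  have h1 : y ^ (-(γ + 2)) ≤ m ^ (-(γ + 2)) :=
    Real.rpow_le_rpow_of_nonpos hm hy (by linarith)
  have hx0 : 0 ≤ x := hm.le.trans hx
  have h2 : (x + y) ^ (-γ) / (x * y) ≤ m ^ (-(γ + 2)) := by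
    rw [neg_add, ← sub_eq_add_neg, Real.rpow_sub hm, Real.rpow_two, sq]
    have := Real.rpow_le_rpow_of_nonpos hm (by linarith : m ≤ x + y) (by linarith : -γ ≤ 0)
    gcongr
  have : (2 + γ) / γ * ((x + y) ^ (-γ) / (x * y)) ≤ (2 + γ) / γ * m ^ (-(γ + 2)) := by
    gcongr
  linarith

/-! ### The subtractive Euclidean algorithm -/

/-- One step of the subtractive Euclidean algorithm. -/
def subStep (s : ℝ × ℝ) : ℝ × ℝ :=
  if s.1 < s.2 then (s.1, s.2 - s.1) else if s.2 < s.1 then (s.1 - s.2, s.2) else s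

/-- Pairs of positive reals with irrational quotient. -/
def IsIncommensurable (s : ℝ × ℝ) : Prop :=
  0 < s.1 ∧ 0 < s.2 ∧ Irrational (s.2 / s.1)

/-- Excludes the tie branch of `subStep`, where the algorithm would become stationary. -/
theorem IsIncommensurable.fst_ne_snd {s : ℝ × ℝ} (h : IsIncommensurable s) : s.1 ≠ s.2 := by
  intro he
  have := h.2.2
  rw [← he, div_self h.1.ne'] at this
  exact not_irrational_one this

theorem IsIncommensurable.swap {s : ℝ × ℝ} (h : IsIncommensurable s) :
    IsIncommensurable s.swap := by
  refine ⟨h.2.1, h.1, ?_⟩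
  have := h.2.2.inv
  rwa [inv_div] at this

theorem subStep_swap (s : ℝ × ℝ) : subStep s.swap = (subStep s).swap := by
  unfold subStep
  rcases lt_trichotomy s.1 s.2 with h | h | h
  · simp [h, h.not_gt]
  · simp [h]
  · simp [h, h.not_gt]

theorem iterate_subStep_swap (n : ℕ) (s : ℝ × ℝ) :
    subStep^[n] s.swap = (subStep^[n] s).swap :=
  (Function.Semiconj.iterate_right (fun s => (subStep_swap s).symm) n).eq s |>.symm

theorem subStep_of_lt {s : ℝ × ℝ} (h : s.1 < s.2) : subStep s = (s.1, s.2 - s.1) := if_pos h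

theorem subStep_of_gt {s : ℝ × ℝ} (h : s.2 < s.1) : subStep s = (s.1 - s.2, s.2) := by
  rw [subStep, if_neg h.not_gt, if_pos h]

theorem subStep_smul {r : ℝ} (hr : 0 < r) (s : ℝ × ℝ) : subStep (r • s) = r • subStep s := by
  rcases lt_trichotomy s.1 s.2 with h | h | h
  · rw [subStep_of_lt h, subStep_of_lt (by simpa using mul_lt_mul_of_pos_left h hr)]
    ext <;> simp [mul_sub]
  · simp [subStep, h]
  · rw [subStep_of_gt h, subStep_of_gt (by simpa using mul_lt_mul_of_pos_left h hr)]
    ext <;> simp [mul_sub]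

theorem iterate_subStep_smul {r : ℝ} (hr : 0 < r) (n : ℕ) (s : ℝ × ℝ) :
    subStep^[n] (r • s) = r • subStep^[n] s :=
  (Function.Semiconj.iterate_right (fun s => (subStep_smul hr s).symm) n).eq s |>.symm

theorem IsIncommensurable.subStep {s : ℝ × ℝ} (h : IsIncommensurable s) :
    IsIncommensurable (subStep s) := by
  have main : ∀ s : ℝ × ℝ, IsIncommensurable s → s.1 < s.2 →
      IsIncommensurable (FreeEnergy.subStep s) := by
    intro s hs hlt
    rw [subStep_of_lt hlt]
    refine ⟨hs.1, sub_pos.2 hlt, ?_⟩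
    have := hs.2.2.sub_natCast 1
    rwa [Nat.cast_one, div_sub_one hs.1.ne'] at this
  rcases h.fst_ne_snd.lt_or_gt with hlt | hgt
  · exact main s h hlt
  · have := (main s.swap h.swap hgt).swap
    rwa [subStep_swap, Prod.swap_swap] at this

theorem IsIncommensurable.iterate {s : ℝ × ℝ} (h : IsIncommensurable s) (n : ℕ) :
    IsIncommensurable (FreeEnergy.subStep^[n] s) := by
  induction n with
  | zero => exact h
  | succ n ih => rw [Function.iterate_succ_apply']; exact ih.subStep

/-- The smaller component of a pair. -/
def pairMin (s : ℝ × ℝ) : ℝ := min s.1 s.2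

/-- The larger component of a pair. -/
def pairMax (s : ℝ × ℝ) : ℝ := max s.1 s.2

theorem pairMin_swap (s : ℝ × ℝ) : pairMin s.swap = pairMin s := min_comm _ _

theorem pairMin_smul {r : ℝ} (hr : 0 < r) (s : ℝ × ℝ) : pairMin (r • s) = r * pairMin s :=
  (mul_min_of_nonneg s.1 s.2 hr.le).symm

theorem pairMax_smul {r : ℝ} (hr : 0 < r) (s : ℝ × ℝ) : pairMax (r • s) = r * pairMax s :=
  (mul_max_of_nonneg s.1 s.2 hr.le).symm

theorem IsIncommensurable.pairMin_pos {s : ℝ × ℝ} (h : IsIncommensurable s) : 0 < pairMin s :=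
  lt_min h.1 h.2.1

theorem pairMin_le_pairMax (s : ℝ × ℝ) : pairMin s ≤ pairMax s := min_le_max

theorem IsIncommensurable.pairMin_subStep_le {s : ℝ × ℝ} (h : IsIncommensurable s) :
    pairMin (FreeEnergy.subStep s) ≤ pairMin s := by
  rcases h.fst_ne_snd.lt_or_gt with hlt | hgt
  · rw [subStep_of_lt hlt, pairMin, pairMin, min_eq_left hlt.le]
    exact min_le_left _ _
  · rw [subStep_of_gt hgt, pairMin, pairMin, min_eq_right hgt.le]
    exact min_le_right _ _

theorem IsIncommensurable.pairMin_iterate_le {s : ℝ × ℝ} (h : IsIncommensurable s) (n : ℕ) :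
    pairMin (FreeEnergy.subStep^[n] s) ≤ pairMin s := by
  induction n with
  | zero => exact le_rfl
  | succ n ih =>
    rw [Function.iterate_succ_apply']
    exact (h.iterate n).pairMin_subStep_le.trans ih

/-! ### Two-sided bounds for the partition function -/

/-- Only the positive child is kept at each level, leaving a single nonnegative summand at depth
`N`. -/
theorem IsIncommensurable.formZ_ge {s : ℝ × ℝ} (h : IsIncommensurable s) {β : ℝ} (hβ : 0 ≤ β)
    (N : ℕ) : pairMax (FreeEnergy.subStep^[N] s) ^ (-β) ≤ formZ N β s.1 s.2 := by
  induction N generalizing s with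
  | zero =>
    rw [formZ_zero, abs_of_pos h.2.1, one_div, ← Real.rpow_neg h.2.1.le]
    exact Real.rpow_le_rpow_of_nonpos h.2.1 (le_max_right _ _) (by linarith)
  | succ N ih =>
    rw [formZ_succ, Function.iterate_succ_apply]
    refine (ih h.subStep).trans ?_
    rcases h.fst_ne_snd.lt_or_gt with hlt | hgt
    · rw [subStep_of_lt hlt]
      exact le_add_of_nonneg_left (formZ_nonneg _ _ _ _)
    · rw [subStep_of_gt hgt]
      exact le_add_of_nonneg_right (formZ_nonneg _ _ _ _)

/-- Each level sheds one mixed-sign child, bounded by `S` times a power of the current minimum.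
Minima decrease along the orbit, so all `N` of these are bounded using the last minimum. -/
theorem exists_formZ_le {β : ℝ} (hβ : 2 < β) :
    ∃ S : ℝ, 0 < S ∧ ∀ (s : ℝ × ℝ), IsIncommensurable s → ∀ N : ℕ,
      formZ N β s.1 s.2 ≤ (1 + S * N) * pairMin (subStep^[N] s) ^ (-β) := by
  obtain ⟨S, hS, hbound⟩ := exists_formZ_neg_left_le hβ
  refine ⟨S, hS, fun s h N => ?_⟩
  induction N generalizing s with
  | zero =>
    rw [formZ_zero, abs_of_pos h.2.1, one_div, ← Real.rpow_neg h.2.1.le]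
    simpa using Real.rpow_le_rpow_of_nonpos h.pairMin_pos (min_le_right _ _)
      (by linarith : -β ≤ 0)
  | succ N ih =>
    have h1 := ih _ h.subStep
    have hmono : pairMin (subStep s) ^ (-β) ≤ pairMin (subStep^[N] (subStep s)) ^ (-β) :=
      Real.rpow_le_rpow_of_nonpos (h.subStep.iterate N).pairMin_pos
        (h.subStep.pairMin_iterate_le N) (by linarith)
    have h2 := mul_le_mul_of_nonneg_left hmono hS.le
    rw [formZ_succ, Function.iterate_succ_apply]
    have key : formZ N β (s.1 - s.2) s.2 + formZ N β s.1 (s.2 - s.1) ≤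
        S * pairMin (subStep s) ^ (-β) + formZ N β (subStep s).1 (subStep s).2 := by
      have hmin := h.subStep.pairMin_pos
      rcases h.fst_ne_snd.lt_or_gt with hlt | hgt
      · rw [subStep_of_lt hlt] at hmin ⊢
        refine add_le_add ?_ le_rfl
        rw [← neg_sub]
        refine hbound N _ _ _ hmin (min_le_right _ _) ((min_le_left _ _).trans hlt.le)
      · rw [subStep_of_gt hgt] at hmin ⊢
        rw [add_comm]
        refine add_le_add ?_ le_rfl
        -- Here the second coefficient is the negative one; a global sign change brings the form to
        -- the shape of `hbound`.
        rw [← formZ_neg, neg_sub]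
        refine hbound N _ _ _ hmin ((min_le_right _ _).trans hgt.le) (min_le_left _ _)
    push_cast
    nlinarith

/-! ### Lagrange's theorem for the subtractive algorithm -/

/-- Positive irrational roots of an integer quadratic form of discriminant `D` whose other root is
negative. -/
def reducedRoots (D : ℤ) : Set ℝ :=
  {t | 0 < t ∧ ∃ a b c : ℤ, a * c < 0 ∧ b ^ 2 - 4 * a * c = D ∧ (a : ℝ) * t ^ 2 + b * t + c = 0}

/-- Since `a c < 0`, `D = b ^ 2 + 4 |a c|` bounds both `a` and `b`; with `D` fixed, these and the
sign of the square root determine the root. -/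
theorem reducedRoots_finite (D : ℤ) : (reducedRoots D).Finite := by
  have hfin : ((Set.Icc (-D) D ×ˢ Set.Icc (-D) D) ×ˢ ({1, -1} : Set ℝ)).Finite :=
    ((Set.finite_Icc _ _).prod (Set.finite_Icc _ _)).prod (Set.toFinite _)
  refine (hfin.image fun w : (ℤ × ℤ) × ℝ =>
    (-(w.1.2 : ℝ) + w.2 * √(D : ℝ)) / (2 * w.1.1)).subset ?_
  rintro t ⟨ht, a, b, c, hac, hD, hroot⟩
  have ha : a ≠ 0 := by rintro rfl; simp at hac
  have hc : c ≠ 0 := by rintro rfl; simp at hac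
  have hc1 : 1 ≤ |c| := Int.one_le_abs hc
  have hac' : |a * c| = -(a * c) := abs_of_neg hac
  rw [abs_mul] at hac'
  have haD : |a| ≤ D := by nlinarith [sq_nonneg b, abs_nonneg a]
  have hbD : |b| ≤ D := by nlinarith [Int.le_self_sq |b|, sq_abs b]
  have hD0 : (0 : ℝ) ≤ D := by exact_mod_cast (abs_nonneg a).trans haD
  have hdisc : discrim (a : ℝ) b c = √(D : ℝ) * √(D : ℝ) := by
    rw [Real.mul_self_sqrt hD0, discrim, ← hD]; push_cast; ring
  have hroot' : (a : ℝ) * (t * t) + b * t + c = 0 := by rw [← sq]; exact hroot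
  rcases (quadratic_eq_zero_iff (by exact_mod_cast ha) hdisc t).1 hroot' with h | h
  · exact ⟨((a, b), 1), ⟨⟨abs_le.1 haD, abs_le.1 hbD⟩, by simp⟩, by rw [h]; simp⟩
  · exact ⟨((a, b), -1), ⟨⟨abs_le.1 haD, abs_le.1 hbD⟩, by simp⟩, by rw [h]; simp; ring⟩

theorem inv_mem_reducedRoots {D : ℤ} {t : ℝ} (h : t ∈ reducedRoots D) :
    t⁻¹ ∈ reducedRoots D := by
  obtain ⟨ht, a, b, c, hac, hD, hroot⟩ := h
  refine ⟨inv_pos.2 ht, c, b, a, by linarith, by linarith, ?_⟩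
  field_simp
  linarith

theorem sub_one_mem_reducedRoots {D : ℤ} {t : ℝ} (h : t ∈ reducedRoots D) (h1 : 1 < t) :
    t - 1 ∈ reducedRoots D := by
  obtain ⟨ht, a, b, c, hac, hD, hroot⟩ := h
  refine ⟨by linarith, a, b + 2 * a, a + b + c, ?_, by linarith, ?_⟩
  · have hacR : (a : ℝ) * c < 0 := by exact_mod_cast hac
    -- The other root is `c / (a t) < 0`, so 1 lies strictly between the roots and the form at 1 has
    -- sign opposite to `a`. This is that factorisation multiplied by `t`.
    have hmul : (a * (a + b + c) : ℝ) * t = -((t - 1) * (a ^ 2 * t - a * c)) := by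
      linear_combination a * hroot
    have hpos : 0 < (t - 1) * (a ^ 2 * t - a * c) :=
      mul_pos (by linarith) (by nlinarith [sq_nonneg (a : ℝ)])
    have : (a * (a + b + c) : ℝ) < 0 := by
      by_contra hcon
      nlinarith [mul_nonneg (not_lt.1 hcon) ht.le]
    exact_mod_cast this
  · push_cast
    linear_combination hroot

/-- The quotient of a pair. -/
def pairRatio (s : ℝ × ℝ) : ℝ := s.2 / s.1

theorem pairRatio_swap (s : ℝ × ℝ) : pairRatio s.swap = (pairRatio s)⁻¹ := (inv_div _ _).symm

theorem pairRatio_subStep_of_lt {s : ℝ × ℝ} (h0 : s.1 ≠ 0) (h : s.1 < s.2) :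
    pairRatio (subStep s) = pairRatio s - 1 := by
  rw [subStep_of_lt h, pairRatio, pairRatio, div_sub_one h0]

theorem inv_pairRatio_subStep_of_gt {s : ℝ × ℝ} (h0 : s.2 ≠ 0) (h : s.2 < s.1) :
    (pairRatio (subStep s))⁻¹ = (pairRatio s)⁻¹ - 1 := by
  rw [← pairRatio_swap, ← pairRatio_swap, ← subStep_swap]
  exact pairRatio_subStep_of_lt (s := s.swap) h0 h

theorem pairRatio_subStep_mem_reducedRoots {D : ℤ} {s : ℝ × ℝ} (hs : IsIncommensurable s)
    (h : pairRatio s ∈ reducedRoots D) : pairRatio (subStep s) ∈ reducedRoots D := by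
  rcases hs.fst_ne_snd.lt_or_gt with hlt | hgt
  · rw [pairRatio_subStep_of_lt hs.1.ne' hlt]
    exact sub_one_mem_reducedRoots h ((one_lt_div hs.1).2 hlt)
  · have := sub_one_mem_reducedRoots (inv_mem_reducedRoots h)
      (by rw [← pairRatio_swap]; exact (one_lt_div hs.2.1).2 hgt)
    rw [← inv_pairRatio_subStep_of_gt hs.2.1.ne' hgt] at this
    simpa using inv_mem_reducedRoots this

/-- A root of an integer quadratic form becomes reduced along the subtractive algorithm. -/
theorem exists_iterate_mem_reducedRoots (k : ℕ) :
    ∀ (s : ℝ × ℝ) (a b c : ℤ), IsIncommensurable s → a ≠ 0 → b.natAbs ≤ k →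
      (a : ℝ) * s.2 ^ 2 + b * (s.1 * s.2) + c * s.1 ^ 2 = 0 →
      ∃ n D, pairRatio (subStep^[n] s) ∈ reducedRoots D := by
  have hred : ∀ (s : ℝ × ℝ) (a b c : ℤ), IsIncommensurable s → a * c < 0 →
      (a : ℝ) * s.2 ^ 2 + b * (s.1 * s.2) + c * s.1 ^ 2 = 0 →
      ∃ n D, pairRatio (subStep^[n] s) ∈ reducedRoots D := by
    intro s a b c hs hac hroot
    refine ⟨0, b ^ 2 - 4 * a * c, div_pos hs.2.1 hs.1, a, b, c, hac, rfl, ?_⟩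
    have := hs.1.ne'
    simp only [Function.iterate_zero, id, pairRatio]
    field_simp
    linarith
  have hc0 : ∀ (s : ℝ × ℝ) (a b c : ℤ), IsIncommensurable s → a ≠ 0 →
      (a : ℝ) * s.2 ^ 2 + b * (s.1 * s.2) + c * s.1 ^ 2 = 0 → c ≠ 0 := by
    rintro s a b c hs ha hroot rfl
    have h1 : (a : ℝ) * s.2 + b * s.1 = 0 := by
      have : s.2 * ((a : ℝ) * s.2 + b * s.1) = 0 := by
        push_cast at hroot; linear_combination hroot
      exact (mul_eq_zero.1 this).resolve_left hs.2.1.ne'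
    have haR : (a : ℝ) ≠ 0 := by exact_mod_cast ha
    apply hs.2.2
    refine ⟨-b / a, ?_⟩
    have := hs.1.ne'
    push_cast
    field_simp
    linarith
  induction k with
  | zero =>
    intro s a b c hs ha hb hroot
    obtain rfl : b = 0 := by omega
    have hc := hc0 s a 0 c hs ha hroot
    refine hred s a 0 c hs ?_ hroot
    by_contra hcon
    have hac : (0 : ℝ) ≤ a * c := by exact_mod_cast not_lt.1 hcon
    have haR : (0 : ℝ) < (a : ℝ) ^ 2 := by positivity
    have h1 := hs.1
    have h2 := hs.2.1
    have e : (a : ℝ) ^ 2 * s.2 ^ 2 + a * c * s.1 ^ 2 = 0 := by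
      push_cast at hroot; linear_combination a * hroot
    have : 0 < (a : ℝ) ^ 2 * s.2 ^ 2 := by positivity
    have : 0 ≤ (a : ℝ) * c * s.1 ^ 2 := by positivity
    linarith
  | succ k ih =>
    -- When `a c > 0`, a positive root forces the middle coefficient to have the sign opposite to
    -- `a`.
    have hsign : ∀ (s : ℝ × ℝ) (a b c : ℤ), IsIncommensurable s → a ≠ 0 → 0 < a * c →
        (a : ℝ) * s.2 ^ 2 + b * (s.1 * s.2) + c * s.1 ^ 2 = 0 → a * b < 0 := by
      intro s a b c hs ha hac hroot
      have hacR : (0 : ℝ) < a * c := by exact_mod_cast hac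
      have h1 := hs.1
      have h2 := hs.2.1
      have e : (a * b : ℝ) * (s.1 * s.2) = -((a : ℝ) ^ 2 * s.2 ^ 2 + a * c * s.1 ^ 2) := by
        linear_combination a * hroot
      have hpos : 0 < (a : ℝ) ^ 2 * s.2 ^ 2 + a * c * s.1 ^ 2 := by positivity
      have : (a * b : ℝ) < 0 := by
        by_contra hcon
        nlinarith [mul_nonneg (not_lt.1 hcon) (mul_pos h1 h2).le]
      exact_mod_cast this
    have main : ∀ (s : ℝ × ℝ) (a b c : ℤ), IsIncommensurable s → a ≠ 0 →
        b.natAbs ≤ k + 1 → s.1 < s.2 →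
        (a : ℝ) * s.2 ^ 2 + b * (s.1 * s.2) + c * s.1 ^ 2 = 0 →
        ∃ n D, pairRatio (subStep^[n] s) ∈ reducedRoots D := by
      intro s a b c hs ha hb hlt hroot
      rcases (mul_ne_zero ha (hc0 s a b c hs ha hroot)).lt_or_gt with hac | hac
      · exact hred s a b c hs hac hroot
      have hroot' : (a : ℝ) * (subStep s).2 ^ 2 + (b + 2 * a : ℤ) *
          ((subStep s).1 * (subStep s).2) + (a + b + c : ℤ) * (subStep s).1 ^ 2 = 0 := by
        rw [subStep_of_lt hlt]
        push_cast
        linear_combination hroot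
      have hfin : ∃ n D, pairRatio (subStep^[n] (subStep s)) ∈ reducedRoots D := by
        rcases (mul_ne_zero ha (hc0 _ _ _ _ hs.subStep ha hroot')).lt_or_gt with hac' | hac'
        · exact hred _ _ _ _ hs.subStep hac' hroot'
        -- Both `b` and `b + 2 a` have sign opposite to `a`, so the step shrinks `|b|` by `2 |a|`;
        -- this drives the induction on `k`.
        · have n1 := hsign _ _ _ _ hs ha hac hroot
          have n2 := hsign _ _ _ _ hs.subStep ha hac' hroot'
          refine ih _ _ _ _ hs.subStep ha ?_ hroot'
          rcases ha.lt_or_gt with h | h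
          · have := pos_of_mul_neg_right n1 h.le
            have := pos_of_mul_neg_right n2 h.le
            omega
          · have := neg_of_mul_neg_right n1 h.le
            have := neg_of_mul_neg_right n2 h.le
            omega
      obtain ⟨n, D, h⟩ := hfin
      exact ⟨n + 1, D, h⟩
    intro s a b c hs ha hb hroot
    rcases hs.fst_ne_snd.lt_or_gt with hlt | hgt
    · exact main s a b c hs ha hb hlt hroot
    · obtain ⟨n, D, h⟩ := main s.swap c b a hs.swap (hc0 s a b c hs ha hroot) hb hgt
        (by simp only [Prod.fst_swap, Prod.snd_swap]; linear_combination hroot)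
      refine ⟨n, D, ?_⟩
      rw [iterate_subStep_swap, pairRatio_swap] at h
      simpa using inv_mem_reducedRoots h

theorem IsQuadraticIrrational.isIncommensurable {α : ℝ} (hα : IsQuadraticIrrational α)
    (hpos : 0 < α) : IsIncommensurable (1, α) :=
  ⟨one_pos, hpos, by simpa using hα.1⟩

theorem IsQuadraticIrrational.finite_range_pairRatio {α : ℝ} (hα : IsQuadraticIrrational α)
    (hpos : 0 < α) : (Set.range fun n => pairRatio (subStep^[n] (1, α))).Finite := by
  have hs := hα.isIncommensurable hpos
  obtain ⟨-, a, b, c, ha, hroot⟩ := hα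
  obtain ⟨m, D, hm⟩ := exists_iterate_mem_reducedRoots b.natAbs (1, α) a b c hs ha le_rfl
    (by simp only; linear_combination hroot)
  have htail : ∀ n, pairRatio (subStep^[n + m] (1, α)) ∈ reducedRoots D := by
    intro n
    induction n with
    | zero => simpa using hm
    | succ n ih =>
      rw [Nat.succ_add, Function.iterate_succ_apply']
      exact pairRatio_subStep_mem_reducedRoots (hs.iterate _) ih
  refine (((Set.finite_Iio m).image fun n => pairRatio (subStep^[n] (1, α))).union
    (reducedRoots_finite D)).subset ?_
  rintro _ ⟨n, rfl⟩
  rcases lt_or_ge n m with h | h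
  · exact Or.inl ⟨n, h, rfl⟩
  · obtain ⟨k, rfl⟩ := Nat.exists_eq_add_of_le' h
    exact Or.inr (htail k)

/-- The orbit of `(1, α)` is eventually periodic up to scaling. -/
theorem IsQuadraticIrrational.exists_iterate_add_eq_smul {α : ℝ} (hα : IsQuadraticIrrational α)
    (hpos : 0 < α) : ∃ (p l : ℕ) (r : ℝ), 0 < l ∧ 0 < r ∧ ∀ n, p ≤ n →
      subStep^[n + l] (1, α) = r • subStep^[n] (1, α) := by
  have hs := hα.isIncommensurable hpos
  obtain ⟨i, j, hij, he⟩ := Set.Finite.exists_lt_map_eq_of_forall_mem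
    (f := fun n => pairRatio (subStep^[n] (1, α))) (fun n => Set.mem_range_self n)
    (hα.finite_range_pairRatio hpos)
  have hi := hs.iterate i
  have hj := hs.iterate j
  -- Equal quotients make the pairs at times `i` and `j` proportional; homogeneity of `subStep`
  -- carries the factor to all later times.
  refine ⟨i, j - i, (subStep^[j] (1, α)).1 / (subStep^[i] (1, α)).1, by omega,
    div_pos hj.1 hi.1, fun n hn => ?_⟩
  obtain ⟨k, rfl⟩ := Nat.exists_eq_add_of_le' hn
  rw [show k + i + (j - i) = k + j by omega, Function.iterate_add_apply,
    Function.iterate_add_apply, ← iterate_subStep_smul (div_pos hj.1 hi.1)]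
  congr 1
  simp only [pairRatio] at he
  have h1 := hi.1.ne'
  have h2 := hj.1.ne'
  rw [div_eq_div_iff h1 h2] at he
  ext
  · simp [h1]
  · simp only [Prod.smul_snd, smul_eq_mul]
    field_simp
    linarith

/-! ### Growth rates of eventually quasi-periodic sequences -/

theorem exists_abs_le_of_eventually_periodic {h : ℕ → ℝ} {p l : ℕ} (hl : 0 < l)
    (hper : ∀ n, p ≤ n → h (n + l) = h n) : ∃ C, ∀ n, |h n| ≤ C := by
  refine ⟨∑ i ∈ Finset.range (p + l), |h i|, fun n => ?_⟩
  induction n using Nat.strong_induction_on with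
  | _ n ih =>
    rcases lt_or_ge n (p + l) with hn | hn
    · exact Finset.single_le_sum (f := fun i => |h i|) (fun i _ => abs_nonneg _)
        (Finset.mem_range.2 hn)
    · obtain ⟨k, rfl⟩ := Nat.exists_eq_add_of_le' (show l ≤ n by omega)
      rw [hper k (by omega)]
      exact ih k (by omega)

/-- Subtracting the linear drift `c / l * n` leaves an eventually periodic, hence bounded, sequence.
-/
theorem tendsto_div_natCast_of_add_eq {g : ℕ → ℝ} {p l : ℕ} {c : ℝ} (hl : 0 < l)
    (hg : ∀ n, p ≤ n → g (n + l) = c + g n) :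
    Tendsto (fun n : ℕ => g n / n) atTop (𝓝 (c / l)) := by
  have hl' : (l : ℝ) ≠ 0 := by positivity
  obtain ⟨C, hC⟩ := exists_abs_le_of_eventually_periodic (h := fun n => g n - c / l * n) hl
    (p := p) (fun n hn => by
      simp only [hg n hn]
      push_cast
      field_simp
      ring)
  have h0 : Tendsto (fun n : ℕ => (g n - c / l * n) / n) atTop (𝓝 0) := by
    refine squeeze_zero_norm (fun n => ?_) (tendsto_const_div_atTop_nhds_zero_nat C)
    rw [Real.norm_eq_abs, abs_div, Nat.abs_cast]
    gcongr
    exact hC n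
  have h1 := h0.add_const (c / l)
  rw [zero_add] at h1
  refine h1.congr' ?_
  filter_upwards [eventually_gt_atTop 0] with n hn
  have : (n : ℝ) ≠ 0 := by positivity
  field_simp
  ring

theorem IsQuadraticIrrational.exists_rate {α : ℝ} (hα : IsQuadraticIrrational α) (hpos : 0 < α) :
    ∃ lam : ℝ,
      Tendsto (fun n : ℕ => -Real.log (pairMin (subStep^[n] (1, α))) / n) atTop (𝓝 lam) ∧
      Tendsto (fun n : ℕ => -Real.log (pairMax (subStep^[n] (1, α))) / n) atTop (𝓝 lam) := by
  have hs := hα.isIncommensurable hpos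
  obtain ⟨p, l, r, hl, hr, hper⟩ := hα.exists_iterate_add_eq_smul hpos
  refine ⟨-Real.log r / l, tendsto_div_natCast_of_add_eq hl (p := p) fun n hn => ?_,
    tendsto_div_natCast_of_add_eq hl (p := p) fun n hn => ?_⟩
  · rw [hper n hn, pairMin_smul hr, Real.log_mul hr.ne' (hs.iterate n).pairMin_pos.ne']
    ring
  · have := (hs.iterate n).pairMin_pos.trans_le (pairMin_le_pairMax _)
    rw [hper n hn, pairMax_smul hr, Real.log_mul hr.ne' this.ne']
    ring

theorem tendsto_log_one_add_mul_div {S : ℝ} (hS : 0 < S) :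
    Tendsto (fun N : ℕ => Real.log (1 + S * N) / N) atTop (𝓝 0) := by
  have hu : Tendsto (fun N : ℕ => 1 + S * (N : ℝ)) atTop atTop :=
    tendsto_atTop_add_const_left _ _ (tendsto_natCast_atTop_atTop.const_mul_atTop hS)
  have h1 := Real.isLittleO_log_id_atTop.tendsto_div_nhds_zero.comp hu
  have h2 : Tendsto (fun N : ℕ => 1 / (N : ℝ) + S) atTop (𝓝 (0 + S)) :=
    (tendsto_const_div_atTop_nhds_zero_nat 1).add_const S
  have h3 := h1.mul h2
  rw [zero_mul] at h3
  refine h3.congr' ?_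
  filter_upwards [eventually_gt_atTop 0] with N hN
  have : (0 : ℝ) < N := by exact_mod_cast hN
  simp only [Function.comp, id]
  field_simp

theorem tendsto_log_diophantineZ_of_pos {α lam β : ℝ} (hs : IsIncommensurable (1, α))
    (hmin : Tendsto (fun n : ℕ => -Real.log (pairMin (subStep^[n] (1, α))) / n) atTop (𝓝 lam))
    (hmax : Tendsto (fun n : ℕ => -Real.log (pairMax (subStep^[n] (1, α))) / n) atTop (𝓝 lam))
    (hβ : 2 < β) :
    Tendsto (fun N : ℕ => Real.log (diophantineZ N α β) / (N : ℝ)) atTop (𝓝 (β * lam)) := by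
  obtain ⟨S, hS, hupper⟩ := exists_formZ_le hβ
  have hup := (tendsto_log_one_add_mul_div hS).add (hmin.const_mul β)
  rw [zero_add] at hup
  refine tendsto_of_tendsto_of_tendsto_of_le_of_le (hmax.const_mul β) hup (fun N => ?_)
    (fun N => ?_)
  · have hM := (hs.iterate N).pairMin_pos.trans_le (pairMin_le_pairMax _)
    have h := Real.log_le_log (by positivity) (hs.formZ_ge (by linarith : 0 ≤ β) N)
    rw [Real.log_rpow hM] at h
    simp only [diophantineZ_eq_formZ]
    rw [← mul_div_assoc]
    gcongr
    linarith
  · have hM := (hs.iterate N).pairMin_pos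
    have hM' := hM.trans_le (pairMin_le_pairMax _)
    have hZ : 0 < formZ N β 1 α :=
      (Real.rpow_pos_of_pos hM' (-β)).trans_le (hs.formZ_ge (by linarith) N)
    have h := Real.log_le_log hZ (hupper _ hs N)
    rw [Real.log_mul (by positivity) (by positivity), Real.log_rpow hM] at h
    simp only [diophantineZ_eq_formZ]
    rw [← mul_div_assoc, ← add_div]
    gcongr
    linarith

theorem tendsto_log_diophantineZ_of_neg {α β : ℝ} (hα : α < 0) (hβ : 2 < β) :
    Tendsto (fun N : ℕ => Real.log (diophantineZ N α β) / (N : ℝ)) atTop (𝓝 0) := by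
  obtain ⟨S, hS, hupper⟩ := exists_formZ_neg_left_le hβ
  have hα' : 0 < -α := by linarith
  have hZ : ∀ N, diophantineZ N α β = formZ N β (-1) (-α) := fun N => (formZ_neg N β 1 α).symm
  -- Following `A_0` alone never changes the second coefficient, so one summand always equals `(-α)
  -- ^ (-β)`.
  have hlow : ∀ (N : ℕ) (x : ℝ), (-α) ^ (-β) ≤ formZ N β (-x) (-α) ∨ x ≤ 0 := by
    intro N
    induction N with
    | zero =>
      intro x
      left
      rw [formZ_zero, abs_of_pos hα', one_div, ← Real.rpow_neg hα'.le]
    | succ N ih =>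
      intro x
      rcases le_or_gt x 0 with hx | hx
      · exact Or.inr hx
      · left
        rw [formZ_succ]
        have e : -x - -α = -(x + -α) := by ring
        rw [e]
        exact ((ih (x + -α)).resolve_right (by linarith)).trans
          (le_add_of_nonneg_right (formZ_nonneg _ _ _ _))
  refine tendsto_of_tendsto_of_tendsto_of_le_of_le
    (tendsto_const_div_atTop_nhds_zero_nat (Real.log ((-α) ^ (-β))))
    (tendsto_const_div_atTop_nhds_zero_nat (Real.log (S * min 1 (-α) ^ (-β))))
    (fun N => ?_) (fun N => ?_)
  · simp only [hZ]
    have := (hlow N 1).resolve_right (by norm_num)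
    gcongr
  · simp only [hZ]
    have h1 := (hlow N 1).resolve_right (by norm_num)
    have h2 := hupper N 1 (-α) (min 1 (-α)) (lt_min one_pos hα') (min_le_left _ _)
      (min_le_right _ _)
    have h3 : 0 < (-α) ^ (-β) := by positivity
    have h4 := h3.trans_le h1
    gcongr

/-! ### Continued fractions -/

theorem fract_pos_of_irrational {t : ℝ} (ht : Irrational t) : 0 < Int.fract t :=
  (Int.fract_nonneg t).lt_of_ne fun h => ht ⟨⌊t⌋, by
    have := Int.self_sub_floor t
    push_cast
    linarith⟩

theorem irrational_inv_fract {t : ℝ} (ht : Irrational t) : Irrational (Int.fract t)⁻¹ :=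
  (ht.sub_intCast ⌊t⌋).inv

theorem one_lt_inv_fract {t : ℝ} (ht : Irrational t) : 1 < (Int.fract t)⁻¹ :=
  (one_lt_inv₀ (fract_pos_of_irrational ht)).2 (Int.fract_lt_one t)

theorem partialQuotient_zero (t : ℝ) : partialQuotient t 0 = ⌊t⌋ :=
  GenContFract.of_h_eq_floor

theorem partialQuotient_succ {t : ℝ} (ht : Irrational t) (n : ℕ) :
    partialQuotient t (n + 1) = partialQuotient (Int.fract t)⁻¹ n := by
  cases n with
  | zero =>
    have h := GenContFract.of_s_head (fract_pos_of_irrational ht).ne'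
    rw [partialQuotient_zero, partialQuotient, GenContFract.partDen_eq_s_b (gp := ⟨1, _⟩) h]
    rfl
  | succ n =>
    simp only [partialQuotient, GenContFract.partDens, Stream'.Seq.map_get?,
      GenContFract.of_s_succ t n]

/-- The complete quotients `[a_n; a_{n+1}, …]` of a continued fraction. -/
def completeQuotient (t : ℝ) (n : ℕ) : ℝ := (fun u => (Int.fract u)⁻¹)^[n] t

theorem partialQuotient_eq_floor {t : ℝ} (ht : Irrational t) (n : ℕ) :
    partialQuotient t n = ⌊completeQuotient t n⌋ := by
  induction n generalizing t with
  | zero => exact partialQuotient_zero t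
  | succ n ih => rw [partialQuotient_succ ht, ih (irrational_inv_fract ht)]; rfl

theorem irrational_completeQuotient {t : ℝ} (ht : Irrational t) (n : ℕ) :
    Irrational (completeQuotient t n) := by
  induction n with
  | zero => exact ht
  | succ n ih =>
    rw [completeQuotient, Function.iterate_succ_apply']
    exact irrational_inv_fract ih

theorem sub_natCast_mem_of_forall {R : Set ℝ} (hR : ∀ t ∈ R, 1 < t → t - 1 ∈ R) {t : ℝ}
    (ht : Irrational t) (hmem : t ∈ R) (k : ℕ) (hk : (k : ℝ) ≤ t) : t - k ∈ R := by
  induction k with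
  | zero => simpa using hmem
  | succ k ih =>
    push_cast at hk ⊢
    have hne : t ≠ k + 1 := fun h => ht.ne_nat (k + 1) (by push_cast; exact h)
    rw [← sub_sub]
    refine hR _ (ih (by linarith)) ?_
    have := lt_of_le_of_ne hk hne.symm
    linarith

theorem fract_mem_of_forall {R : Set ℝ} (hR : ∀ t ∈ R, 1 < t → t - 1 ∈ R) {t : ℝ}
    (ht : Irrational t) (hpos : 0 < t) (hmem : t ∈ R) : Int.fract t ∈ R := by
  have := sub_natCast_mem_of_forall hR ht hmem ⌊t⌋₊ (Nat.floor_le hpos.le)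
  rwa [natCast_floor_eq_intCast_floor hpos.le, Int.self_sub_floor] at this

/-- Lagrange's theorem: the continued fraction of a quadratic irrational is eventually periodic. -/
theorem IsQuadraticIrrational.partialQuotient_periodic {α : ℝ} (hα : IsQuadraticIrrational α)
    (hpos : 0 < α) : ∃ p l : ℕ, 0 < l ∧
      ∀ n : ℕ, p ≤ n → partialQuotient α (n + l) = partialQuotient α n := by
  have hs := hα.isIncommensurable hpos
  set O := Set.range fun n => pairRatio (subStep^[n] (1, α)) with hO
  have hOfin : O.Finite := hα.finite_range_pairRatio hpos
  -- Adjoining inverses removes the need to track which component is larger: `R` is closed under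
  -- inversion and under subtracting 1 above 1, so it contains every complete quotient. Pigeonhole
  -- then gives the period.
  set R := O ∪ (fun t => t⁻¹) '' O with hRdef
  have hRfin : R.Finite := hOfin.union (hOfin.image _)
  have hRinv : ∀ t ∈ R, t⁻¹ ∈ R := by
    rintro t (h | ⟨u, hu, rfl⟩)
    · exact Or.inr ⟨t, h, rfl⟩
    · exact Or.inl (by simpa using hu)
  have hRsub : ∀ t ∈ R, 1 < t → t - 1 ∈ R := by
    rintro t (⟨n, rfl⟩ | ⟨_, ⟨n, rfl⟩, rfl⟩) h1
    · have hn := hs.iterate n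
      refine Or.inl ⟨n + 1, ?_⟩
      simp only [Function.iterate_succ_apply']
      exact pairRatio_subStep_of_lt hn.1.ne' ((one_lt_div hn.1).1 h1)
    · have hn := hs.iterate n
      refine Or.inr ⟨_, ⟨n + 1, rfl⟩, ?_⟩
      simp only [Function.iterate_succ_apply']
      simp only [← pairRatio_swap] at h1
      exact inv_pairRatio_subStep_of_gt hn.2.1.ne' ((one_lt_div hn.2.1).1 h1)
  have hmem : ∀ n, 0 < completeQuotient α n ∧ completeQuotient α n ∈ R := by
    intro n
    induction n with
    | zero => exact ⟨hpos, Or.inl ⟨0, by simp [pairRatio, completeQuotient]⟩⟩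
    | succ n ih =>
      have hirr := irrational_completeQuotient hα.1 n
      rw [completeQuotient, Function.iterate_succ_apply']
      exact ⟨inv_pos.2 (fract_pos_of_irrational hirr),
        hRinv _ (fract_mem_of_forall hRsub hirr ih.1 ih.2)⟩
  obtain ⟨i, j, hij, he⟩ := Set.Finite.exists_lt_map_eq_of_forall_mem
    (fun n => (hmem n).2) hRfin
  refine ⟨i, j - i, by omega, fun n hn => ?_⟩
  obtain ⟨k, rfl⟩ := Nat.exists_eq_add_of_le' hn
  rw [partialQuotient_eq_floor hα.1, partialQuotient_eq_floor hα.1,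
    show k + i + (j - i) = k + j by omega]
  simp only [completeQuotient] at he ⊢
  rw [Function.iterate_add_apply, Function.iterate_add_apply, he]

/-- The sum of the partial quotients up to index `m`, as a natural number. -/
def cfSteps : ℕ → ℝ → ℕ
  | 0, t => ⌊t⌋₊
  | m + 1, t => ⌊t⌋₊ + cfSteps m (Int.fract t)⁻¹

/-- The product of the fractional parts of the complete quotients up to index `m`. -/
def cfError : ℕ → ℝ → ℝ
  | 0, t => Int.fract t
  | m + 1, t => Int.fract t * cfError m (Int.fract t)⁻¹

theorem cfIndex_eq_cfSteps (m : ℕ) {t : ℝ} (ht : Irrational t) (hpos : 0 < t) :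
    cfIndex t m = cfSteps m t := by
  induction m generalizing t with
  | zero =>
    simp [cfIndex, partialQuotient_zero, cfSteps, natCast_floor_eq_intCast_floor hpos.le]
  | succ m ih =>
    have h := ih (irrational_inv_fract ht) (inv_pos.2 (fract_pos_of_irrational ht))
    rw [cfSteps, Nat.cast_add, ← h, cfIndex, Finset.sum_range_succ', partialQuotient_zero,
      natCast_floor_eq_intCast_floor hpos.le, add_comm]
    congr 1
    exact Finset.sum_congr rfl fun i _ => partialQuotient_succ ht i

theorem lt_cfSteps_of_one_lt (m : ℕ) {t : ℝ} (ht : Irrational t) (h1 : 1 < t) :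
    m < cfSteps m t := by
  have hfl : 1 ≤ ⌊t⌋₊ := Nat.le_floor (by simpa using h1.le)
  induction m generalizing t with
  | zero => exact hfl
  | succ m ih =>
    have h1' := one_lt_inv_fract ht
    have := ih (irrational_inv_fract ht) h1' (Nat.le_floor (by simpa using h1'.le))
    rw [cfSteps]
    omega

/-- Every partial quotient after the first is at least 1; only `a_0` may vanish, hence the separate
treatment of index 0. -/
theorem tendsto_cfSteps {t : ℝ} (ht : Irrational t) :
    Tendsto (fun m => cfSteps m t) atTop atTop := by
  refine tendsto_atTop_mono (fun m => ?_) tendsto_id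
  cases m with
  | zero => exact Nat.zero_le _
  | succ m =>
    have := lt_cfSteps_of_one_lt m (irrational_inv_fract ht) (one_lt_inv_fract ht)
    simp only [cfSteps, id]
    omega

theorem cfError_pos (m : ℕ) {t : ℝ} (ht : Irrational t) : 0 < cfError m t := by
  induction m generalizing t with
  | zero => exact fract_pos_of_irrational ht
  | succ m ih => exact mul_pos (fract_pos_of_irrational ht) (ih (irrational_inv_fract ht))

theorem iterate_subStep_of_natCast_le {x t : ℝ} (hx : 0 < x) (ht : Irrational t) (k : ℕ)
    (hk : (k : ℝ) ≤ t) : subStep^[k] (x, t * x) = (x, (t - k) * x) := by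
  induction k with
  | zero => simp
  | succ k ih =>
    push_cast at hk
    have hne : t ≠ k + 1 := fun h => ht.ne_nat (k + 1) (by push_cast; exact h)
    have hlt := lt_of_le_of_ne hk hne.symm
    rw [Function.iterate_succ_apply', ih (by linarith), subStep_of_lt (by simp only; nlinarith)]
    push_cast
    ext
    · rfl
    · simp only; ring

theorem iterate_subStep_floor {x t : ℝ} (hx : 0 < x) (ht : Irrational t) (hpos : 0 < t) :
    subStep^[⌊t⌋₊] (x, t * x) = (x, Int.fract t * x) := by
  rw [iterate_subStep_of_natCast_le hx ht _ (Nat.floor_le hpos.le),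
    natCast_floor_eq_intCast_floor hpos.le, Int.self_sub_floor]

/-- A block of `⌊t⌋` subtractions is one Euclidean division; swapping the components then restarts
the process with `1 / fract t`. -/
theorem pairMin_iterate_cfSteps (m : ℕ) {x t : ℝ} (hx : 0 < x) (ht : Irrational t)
    (hpos : 0 < t) : pairMin (subStep^[cfSteps m t] (x, t * x)) = cfError m t * x := by
  induction m generalizing x t with
  | zero =>
    rw [cfSteps, iterate_subStep_floor hx ht hpos]
    exact min_eq_right (by nlinarith [Int.fract_lt_one t])
  | succ m ih =>
    have hf := fract_pos_of_irrational ht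
    have hswap : (x, Int.fract t * x) =
        (Int.fract t * x, (Int.fract t)⁻¹ * (Int.fract t * x)).swap := by
      rw [inv_mul_cancel_left₀ hf.ne']
      rfl
    rw [cfSteps, add_comm, Function.iterate_add_apply, iterate_subStep_floor hx ht hpos, hswap,
      iterate_subStep_swap, pairMin_swap, ih (mul_pos hf hx) (irrational_inv_fract ht)
      (inv_pos.2 hf), cfError]
    ring

theorem convergent_pos (n : ℕ) {t : ℝ} (ht : Irrational t) (h1 : 1 < t) :
    0 < t.convergent n := by
  have hfl : (1 : ℚ) ≤ ⌊t⌋ := by exact_mod_cast Int.le_floor.2 (by simpa using h1.le)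
  induction n generalizing t with
  | zero => rw [Real.convergent_zero]; linarith
  | succ n ih =>
    have h1' := one_lt_inv_fract ht
    have := ih (irrational_inv_fract ht) h1'
      (by exact_mod_cast Int.le_floor.2 (by simpa using h1'.le))
    rw [Real.convergent_succ]
    positivity

/-- Adding an integer keeps the reduced denominator, and inverting a positive rational exchanges
numerator and denominator. -/
theorem den_convergent_succ (n : ℕ) {t : ℝ} (ht : Irrational t) :
    ((t.convergent (n + 1)).den : ℤ) = ((Int.fract t)⁻¹.convergent n).num := by
  have h := convergent_pos n (irrational_inv_fract ht) (one_lt_inv_fract ht)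
  rw [Real.convergent_succ, Rat.intCast_add_den, Rat.den_inv_of_ne_zero h.ne',
    Int.natAbs_of_nonneg (Rat.num_pos.2 h).le]

theorem num_convergent_succ (n : ℕ) {t : ℝ} (ht : Irrational t) :
    (t.convergent (n + 1)).num =
      ⌊t⌋ * ((Int.fract t)⁻¹.convergent n).num + ((Int.fract t)⁻¹.convergent n).den := by
  have h := convergent_pos n (irrational_inv_fract ht) (one_lt_inv_fract ht)
  have hden := den_convergent_succ n ht
  have e := Rat.mul_den_eq_num (t.convergent (n + 1))
  have e' := Rat.mul_den_eq_num ((Int.fract t)⁻¹.convergent n)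
  rw [← Int.cast_natCast, hden] at e
  have : ((t.convergent (n + 1)).num : ℚ) =
      ⌊t⌋ * ((Int.fract t)⁻¹.convergent n).num + ((Int.fract t)⁻¹.convergent n).den := by
    rw [← e, Real.convergent_succ, ← e']
    generalize (Int.fract t)⁻¹.convergent n = r at h
    field_simp
  exact_mod_cast this

theorem abs_mul_den_sub_num (n : ℕ) {t : ℝ} (ht : Irrational t) :
    |t * (t.convergent n).den - (t.convergent n).num| = cfError n t := by
  induction n generalizing t with
  | zero =>
    rw [Real.convergent_zero, Rat.den_intCast, Rat.num_intCast, cfError, Nat.cast_one, mul_one,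
      Int.self_sub_floor, abs_of_nonneg (Int.fract_nonneg t)]
  | succ n ih =>
    have hf := fract_pos_of_irrational ht
    have hden : ((t.convergent (n + 1)).den : ℝ) = ((Int.fract t)⁻¹.convergent n).num := by
      exact_mod_cast den_convergent_succ n ht
    have hmul : ∀ z : ℝ, Int.fract t * |z| = |Int.fract t * z| := fun z => by
      rw [abs_mul, abs_of_pos hf]
    -- With `t' = 1 / fract t` and its convergent `p' / q'`, the new error is `fract t * p' - q' =
    -- fract t * (p' - t' * q')`.
    rw [cfError, ← ih (irrational_inv_fract ht), hden, num_convergent_succ n ht, abs_sub_comm,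
      hmul, mul_sub, mul_inv_cancel_left₀ hf.ne']
    congr 1
    push_cast
    linear_combination (((Int.fract t)⁻¹.convergent n).num : ℝ) * Int.floor_add_fract t

/-- The two bounds need each other: a denominator at one level is a numerator at the previous one.
-/
theorem cfError_mul_le (n : ℕ) {t : ℝ} (ht : Irrational t) (hpos : 0 < t) :
    cfError n t * (t.convergent n).den ≤ 1 ∧ cfError n t * (t.convergent n).num ≤ t := by
  have hfl : (0 : ℝ) ≤ ⌊t⌋ := by exact_mod_cast Int.floor_nonneg.2 hpos.le
  have hsum := Int.floor_add_fract t
  have hf := fract_pos_of_irrational ht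
  have hf1 := Int.fract_lt_one t
  induction n generalizing t with
  | zero =>
    rw [Real.convergent_zero, Rat.den_intCast, Rat.num_intCast, cfError]
    constructor
    · simpa using hf1.le
    · nlinarith
  | succ n ih =>
    have ht' := irrational_inv_fract ht
    have hpos' := inv_pos.2 hf
    obtain ⟨i1, i2⟩ := ih ht' hpos' (by exact_mod_cast Int.floor_nonneg.2 hpos'.le)
      (Int.floor_add_fract _) (fract_pos_of_irrational ht') (Int.fract_lt_one _)
    have i3 := mul_le_mul_of_nonneg_left i2 hf.le
    rw [mul_inv_cancel₀ hf.ne'] at i3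
    have hden : ((t.convergent (n + 1)).den : ℝ) = ((Int.fract t)⁻¹.convergent n).num := by
      exact_mod_cast den_convergent_succ n ht
    rw [cfError, hden, num_convergent_succ n ht]
    push_cast
    constructor
    · linarith
    · nlinarith [mul_le_mul_of_nonneg_left i3 hfl, mul_le_mul_of_nonneg_left i1 hf.le]

/-- Liouville's inequality for quadratic irrationals. -/
theorem IsQuadraticIrrational.exists_one_le_mul {α : ℝ} (hα : IsQuadraticIrrational α) :
    ∃ K : ℝ, 0 < K ∧ ∀ (p : ℤ) (q : ℕ), 0 < q → 1 ≤ K * (|α * q - p| * q) := by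
  obtain ⟨hirr, a, b, c, ha, hroot⟩ := hα
  refine ⟨|(a : ℝ)| * (2 * |α| + 1) + |(b : ℝ)| + 1, by positivity, fun p q hq => ?_⟩
  have hq1 : (1 : ℝ) ≤ q := by exact_mod_cast hq
  have hq0 : (q : ℝ) ≠ 0 := by positivity
  have hM : 0 ≤ |(a : ℝ)| * (2 * |α| + 1) + |(b : ℝ)| := by positivity
  rcases le_or_gt 1 |α * q - p| with hbig | hsmall
  · have : 1 ≤ |α * q - p| * q := by nlinarith
    nlinarith
  -- The homogenised polynomial takes a nonzero integer value here, and one of its factors is `p - α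
  -- q`; the other is `O(q)` because `|α q - p| < 1`.
  have hfac : ((a * p ^ 2 + b * p * q + c * q ^ 2 : ℤ) : ℝ) =
      (p - α * q) * (a * (p + α * q) + b * q) := by
    push_cast
    linear_combination (q : ℝ) ^ 2 * hroot
  have hne : a * p ^ 2 + b * p * q + c * q ^ 2 ≠ 0 := by
    intro h0
    rw [h0, Int.cast_zero, eq_comm, mul_eq_zero] at hfac
    have haR : (a : ℝ) ≠ 0 := by exact_mod_cast ha
    rcases hfac with h | h
    · refine hirr ⟨p / q, ?_⟩
      push_cast
      field_simp
      linarith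
    · refine hirr ⟨-(a * p + b * q) / (a * q), ?_⟩
      push_cast
      field_simp
      linarith
  have h1 : (1 : ℝ) ≤ |((a * p ^ 2 + b * p * q + c * q ^ 2 : ℤ) : ℝ)| := by
    exact_mod_cast Int.one_le_abs hne
  rw [hfac, abs_mul, abs_sub_comm] at h1
  have h2 : |a * (p + α * q) + b * q| ≤ (|(a : ℝ)| * (2 * |α| + 1) + |(b : ℝ)|) * q := by
    have hsplit : (p + α * q : ℝ) = 2 * (α * q) - (α * q - p) := by ring
    have h3 : |(p + α * q : ℝ)| ≤ (2 * |α| + 1) * q := by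
      rw [hsplit]
      refine (abs_sub _ _).trans ?_
      rw [abs_mul, abs_mul, abs_two, Nat.abs_cast]
      nlinarith
    refine (abs_add_le _ _).trans ?_
    rw [abs_mul, abs_mul, Nat.abs_cast, add_mul, mul_assoc]
    gcongr
  have h4 := mul_le_mul_of_nonneg_left h2 (abs_nonneg (α * q - p))
  nlinarith [mul_nonneg (abs_nonneg (α * q - p)) (by positivity : (0 : ℝ) ≤ q)]

theorem IsQuadraticIrrational.tendsto_log_cfDen {α lam : ℝ} (hα : IsQuadraticIrrational α)
    (hpos : 0 < α)
    (hmin : Tendsto (fun n : ℕ => -Real.log (pairMin (subStep^[n] (1, α))) / n) atTop (𝓝 lam)) :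
    Tendsto (fun m : ℕ => Real.log (cfDen α m) / cfIndex α m) atTop (𝓝 lam) := by
  obtain ⟨K, hK, hliou⟩ := hα.exists_one_le_mul
  have hsteps := tendsto_cfSteps hα.1
  have hup := hmin.comp hsteps
  have hconst := (tendsto_const_div_atTop_nhds_zero_nat (-Real.log K)).comp hsteps
  have hlow := hconst.add hup
  rw [zero_add] at hlow
  have hmineq : ∀ m, pairMin (subStep^[cfSteps m α] (1, α)) = cfError m α := fun m => by
    simpa using pairMin_iterate_cfSteps m one_pos hα.1 hpos
  have hdpos : ∀ m, (0 : ℝ) < (α.convergent m).den := fun m => by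
    exact_mod_cast (α.convergent m).den_pos
  refine tendsto_of_tendsto_of_tendsto_of_le_of_le hlow hup (fun m => ?_) (fun m => ?_)
  · simp only [Function.comp, hmineq, cfIndex_eq_cfSteps m hα.1 hpos, cfDen]
    rw [← add_div]
    gcongr
    have h := hliou (α.convergent m).num (α.convergent m).den (α.convergent m).den_pos
    have he := cfError_pos m hα.1
    have hd := hdpos m
    rw [abs_mul_den_sub_num m hα.1] at h
    have := Real.log_nonneg h
    -- Liouville's bound costs only the constant `log K`, which vanishes after division by `N_m`.
    rw [Real.log_mul hK.ne' (by positivity), Real.log_mul he.ne' hd.ne'] at this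
    linarith
  · simp only [Function.comp, hmineq, cfIndex_eq_cfSteps m hα.1 hpos, cfDen]
    gcongr
    have he := cfError_pos m hα.1
    have hd := hdpos m
    have := Real.log_nonpos (by positivity) (cfError_mul_le m hα.1 hpos).1
    rw [Real.log_mul he.ne' hd.ne'] at this
    linarith

end FreeEnergy

end

theorem theorem4p5 (α : ℝ) (hα : FreeEnergy.IsQuadraticIrrational α) :
    FreeEnergy.HasFreeEnergyLimit 1 α 2 ∧
    (0 < α →
      (∃ p l : ℕ, 0 < l ∧
        ∀ n : ℕ, p ≤ n → FreeEnergy.partialQuotient α (n + l) = FreeEnergy.partialQuotient α n) ∧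
      ∃ lam : ℝ,
        Tendsto (fun m : ℕ => Real.log (FreeEnergy.cfDen α m) / FreeEnergy.cfIndex α m)
          atTop (𝓝 lam) ∧
        ∀ β : ℝ, 2 < β →
          Tendsto (fun N : ℕ => Real.log (FreeEnergy.diophantineZ N α β) / (N : ℝ))
            atTop (𝓝 (β * lam))) := by
  have hlim : 0 < α → ∃ lam : ℝ,
      Tendsto (fun m : ℕ => Real.log (FreeEnergy.cfDen α m) / FreeEnergy.cfIndex α m)
        atTop (𝓝 lam) ∧
      ∀ β : ℝ, 2 < β →
        Tendsto (fun N : ℕ => Real.log (FreeEnergy.diophantineZ N α β) / (N : ℝ))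
          atTop (𝓝 (β * lam)) := by
    intro hpos
    obtain ⟨lam, hmin, hmax⟩ := hα.exists_rate hpos
    exact ⟨lam, hα.tendsto_log_cfDen hpos hmin, fun β hβ =>
      FreeEnergy.tendsto_log_diophantineZ_of_pos (hα.isIncommensurable hpos) hmin hmax hβ⟩
  refine ⟨fun β hβ => ?_, fun hpos => ⟨hα.partialQuotient_periodic hpos, hlim hpos⟩⟩
  simp only [Real.rpow_one]
  rcases hα.1.ne_zero.lt_or_gt with hneg | hpos
  · exact ⟨0, FreeEnergy.tendsto_log_diophantineZ_of_neg hneg hβ⟩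
  · obtain ⟨lam, -, h⟩ := hlim hpos
    exact ⟨β * lam, h β hβ⟩
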